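/- Let $0<q<1$ and $\nu>-1$. Put $(a;q)_0=1$, $(a;q)_n=\prod_{k=1}^{n}(1-aq^{k-1})$, $(a;q)_\infty=\prod_{k\ge1}(1-aq^{k-1})$, let $$J_\nu^{(3)}(z;q)=\frac{(q^{\nu+1};q)_\infty}{(q;q)_\infty}\sum_{n\ge0}\frac{(-1)^n z^{2n+\nu}}{(q;q)_n(q^{\nu+1};q)_n}\,q^{\frac12 n(n+1)}$$ be the Hahn-Exton $q$-Bessel function, and let $$h_\nu^{(3)}(z;q)=c_\nu(q)\,z^{1-\frac{\nu}{2}}J_\nu^{(3)}(\sqrt z;q),\qquad c_\nu(q)=\frac{(q;q)_\infty}{(q^{\nu+1};q)_\infty}.$$ For a function $f$ analytic near $0$ with $f(0)=f'(0)-1=0$, the radius of starlikeness $r^*(f)$ is the supremum of all $r>0$ such that $f$ is analytic in $|z|<r$ and $\operatorname{Re}\big(zf'(z)/f(z)\big)>0$ for all $|z|<r$ (the quotient having the value $1$ at $z=0$). Then $r^*=r^*\big(h_\nu^{(3)}(\cdot;q)\big)$ is the smallest positive root $r$ of the equation $$\sqrt r\,\frac{dJ_\nu^{(3)}}{dz}(\sqrt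 r;q)-(\nu-2)\,J_\nu^{(3)}(\sqrt r;q)=0,$$ and it satisfies the inequalities $$\frac{(1-q)(1-q^{\nu+1})}{2q}<r^*<\frac{(q^2-1)(q^{\nu+1}-1)(q^{\nu+2}-1)}{q\,(q-q^{\nu+2}+2q^{\nu+3}-2)}$$ and $$\frac{(q-1)(q^{\nu+1}-1)}{2q}\sqrt{\frac{2(q^{\nu+2}-1)(q+1)}{q-q^{\nu+2}+2q^{\nu+3}-2}}<r^*<\frac{(q^{\nu+1}-1)(q^{\nu+3}-1)(1-q)}{q(q+1)}\,q_4^*(\nu),$$ where $$q_4^*(\nu)=\frac{(q-q^{\nu+2}+2q^{\nu+3}-2)(q^3+2q^2+2q+1)}{q+q^2-q^3-4-5q^{\nu+2}+3q^{\nu+3}+10q^{\nu+4}+3q^{\nu+5}-5q^{\nu+6}-q^{2\nu+5}+q^{2\nu+6}+q^{2\nu+7}-4q^{2\nu+8}}.$$ -/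

import Mathlib

noncomputable section

/-- The finite `q`-shifted factorial `(a; q)_n = ∏_{k=1}^{n} (1 - a q^{k-1})`. -/
def qPoch (a q : ℝ) (n : ℕ) : ℝ := ∏ k ∈ Finset.range n, (1 - a * q ^ k)

/-- The infinite `q`-shifted factorial `(a; q)_∞ = ∏_{k≥1} (1 - a q^{k-1})`
(an absolutely convergent product for `|q| < 1`). -/
def qPochInf (a q : ℝ) : ℝ := ∏' k : ℕ, (1 - a * q ^ k)

/-- The Hahn-Exton `q`-Bessel function `J_ν^{(3)}(z; q)`, with the principal branch of the powers.
The exponent `n * (n + 1) / 2` is an exact division of natural numbers. -/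
def hahnExton (ν q : ℝ) (z : ℂ) : ℂ :=
  ((qPochInf (q ^ (ν + 1)) q / qPochInf q q : ℝ) : ℂ) *
    ∑' n : ℕ, (-1) ^ n * z ^ (2 * (n : ℂ) + (ν : ℂ)) /
      ((qPoch q q n : ℂ) * (qPoch (q ^ (ν + 1)) q n : ℂ)) * (q : ℂ) ^ (n * (n + 1) / 2)

/-- The normalizing constant `c_ν(q) = (q; q)_∞ / (q^{ν+1}; q)_∞`. -/
def cNorm (ν q : ℝ) : ℝ := qPochInf q q / qPochInf (q ^ (ν + 1)) q

/-- The normalized function `h_ν^{(3)}(z; q) = c_ν(q) z^{1-ν/2} J_ν^{(3)}(√z; q)`.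
With principal branches `z ^ (1 - ν / 2) * (√z) ^ (2 * n + ν) = z ^ (n + 1)` for every `z ≠ 0`, so
the branch cuts cancel. -/
def hNorm (ν q : ℝ) (z : ℂ) : ℂ :=
  (cNorm ν q : ℂ) * z ^ (1 - (ν : ℂ) / 2) * hahnExton ν q (z ^ (1 / 2 : ℂ))

/-- The radius of starlikeness: the supremum of the `r > 0` such that `f` is analytic in the disk
`|z| < r` and `Re (z f'(z) / f(z)) > 0` there.  At the origin the quotient stands for its
limit, which is `1` when `f(0) = 0` and `f'(0) = 1`, so only `z ≠ 0` is to be tested.  At a zero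
`z ≠ 0` of `f` the inequality fails (division by zero gives zero). -/
def starlikenessRadius (f : ℂ → ℂ) : ℝ :=
  sSup {r : ℝ | 0 < r ∧ DifferentiableOn ℂ f (Metric.ball 0 r) ∧
    ∀ z ∈ Metric.ball (0 : ℂ) r, z ≠ 0 → 0 < (z * deriv f z / f z).re}

/-- The quantity `q_4^*(ν)`. -/
def qFourStar (ν q : ℝ) : ℝ :=
  (q - q ^ (ν + 2) + 2 * q ^ (ν + 3) - 2) * (q ^ 3 + 2 * q ^ 2 + 2 * q + 1) /
    (q + q ^ 2 - q ^ 3 - 4 - 5 * q ^ (ν + 2) + 3 * q ^ (ν + 3) + 10 * q ^ (ν + 4)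
      + 3 * q ^ (ν + 5) - 5 * q ^ (ν + 6) - q ^ (2 * ν + 5) + q ^ (2 * ν + 6)
      + q ^ (2 * ν + 7) - 4 * q ^ (2 * ν + 8))

end

/-! ### Polynomials with positive, `q`-separated roots -/

noncomputable section
open Polynomial Finset

/-! Put `a = q^(ν+1)`. The branch cuts cancel and `h(z) = z P(z)` with `P = ∑ c_n z^n` entire. With
`Q = h' = ∑ (n+1) c_n z^n`, the starlikeness quotient is `Q/P`, and the equation in `√r` says `Q(r)
= 0` (`hahnExton_equation`).

`P` is a limit of polynomials with positive roots. Begin with `∏ (1 - q^(i+1) z)`, whose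
coefficients the `q`-binomial theorem gives, and multiply the `n`-th coefficient by `(1 - a q^(k+n))
/ (1 - a q^k)` for successive `k`; the products tend to `1/(a;q)_n`. Each multiplication keeps the
roots positive and separated by the factor `q` (`QSeparated.qShift`). By Rolle the roots `x_i` of
the derivative of `X` times such a polynomial interlace with its own roots `y_i`.

In the limit (`exists_first_zero`) the first roots `x_0`, `y_0` tend, along a subsequence, to `ρ <
η`, and `ρ` is the first positive zero of `Q`. As `Q/P` is a limit of functions `1 - ∑ (z/y_i)/(1 -
z/y_i)`, its real part at `z` is at least its value at `|z|`, which is positive for `|z| < ρ`; at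
`ρ` the quotient is `0`. So `ρ` is the radius.

The bounds are the Euler-Rayleigh inequalities `S_k^(-1/k) < ρ < S_k/S_(k+1)` for `k = 1, 2`, where
`S_k`, the limit of `∑ x_i^(-k)`, is a polynomial in the first coefficients of `Q`. -/

/-- The polynomial `∏_{i<N} (1 - X / x_i)` with constant coefficient `1` and roots `x_i`. -/
def rootProd (x : ℕ → ℝ) (N : ℕ) : ℝ[X] := ∏ i ∈ range N, (1 - C (x i)⁻¹ * X)

lemma eval_rootProd (x : ℕ → ℝ) (N : ℕ) (z : ℝ) :
    (rootProd x N).eval z = ∏ i ∈ range N, (1 - (x i)⁻¹ * z) := by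
  simp [rootProd, eval_prod]

lemma coeff_zero_rootProd (x : ℕ → ℝ) (N : ℕ) : (rootProd x N).coeff 0 = 1 := by
  rw [coeff_zero_eq_eval_zero, eval_rootProd]
  simp

lemma rootProd_succ (x : ℕ → ℝ) (N : ℕ) :
    rootProd x (N + 1) = rootProd x N * (1 - C (x N)⁻¹ * X) := by
  simp [rootProd, prod_range_succ]

lemma coeff_succ_rootProd_succ (x : ℕ → ℝ) (N n : ℕ) :
    (rootProd x (N + 1)).coeff (n + 1) =
      (rootProd x N).coeff (n + 1) - (x N)⁻¹ * (rootProd x N).coeff n := by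
  rw [rootProd_succ, mul_sub, mul_one, mul_left_comm, coeff_sub, coeff_C_mul, coeff_mul_X]

lemma natDegree_rootProd_le (x : ℕ → ℝ) (N : ℕ) : (rootProd x N).natDegree ≤ N := by
  induction N with
  | zero => simp [rootProd]
  | succ N ih =>
    rw [rootProd_succ]
    refine natDegree_mul_le.trans (add_le_add ih ?_)
    refine (natDegree_sub_le _ _).trans ?_
    simp only [natDegree_one, zero_le, sup_of_le_right]
    exact (natDegree_C_mul_le _ _).trans natDegree_X_le

lemma eval_rootProd_root {x : ℕ → ℝ} {N i : ℕ} (hi : i < N) (hx : x i ≠ 0) :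
    (rootProd x N).eval (x i) = 0 := by
  rw [eval_rootProd]
  exact prod_eq_zero (mem_range.2 hi) (by field_simp; simp)

/-- The two sides have degree at most `N` and agree at `N + 1` points: the `x i` and `0`. -/
lemma eq_rootProd {W : ℝ[X]} {N : ℕ} {x : ℕ → ℝ} (hd : W.natDegree ≤ N) (h0 : W.coeff 0 = 1)
    (hpos : ∀ i < N, 0 < x i) (hlt : ∀ i j, i < j → j < N → x i < x j)
    (hroot : ∀ i < N, W.eval (x i) = 0) : W = rootProd x N := by
  classical
  have hinj : Set.InjOn x (range N : Set ℕ) := by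
    intro i hi j hj hij
    simp only [coe_range, Set.mem_Iio] at hi hj
    rcases lt_trichotomy i j with h | h | h
    · exact absurd hij (hlt i j h hj).ne
    · exact h
    · exact absurd hij (hlt j i h hi).ne'
  have hn : (0 : ℝ) ∉ (range N).image x := by
    intro h
    obtain ⟨i, hi, h⟩ := mem_image.1 h
    exact (hpos i (mem_range.1 hi)).ne' h
  have hcard : (insert 0 ((range N).image x)).card = N + 1 := by
    rw [card_insert_of_notMem hn, card_image_of_injOn hinj, card_range]
  refine eq_of_degrees_lt_of_eval_finset_eq (insert 0 ((range N).image x)) ?_ ?_ ?_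
  · rw [hcard]
    exact (degree_le_of_natDegree_le hd).trans_lt (by exact_mod_cast N.lt_succ_self)
  · rw [hcard]
    exact (degree_le_of_natDegree_le (natDegree_rootProd_le x N)).trans_lt
      (by exact_mod_cast N.lt_succ_self)
  · intro z hz
    rcases mem_insert.1 hz with rfl | hz
    · rw [← coeff_zero_eq_eval_zero, ← coeff_zero_eq_eval_zero, h0, coeff_zero_rootProd]
    · obtain ⟨i, hi, rfl⟩ := mem_image.1 hz
      have hi := mem_range.1 hi
      rw [hroot i hi, eval_rootProd_root hi (hpos i hi).ne']

/-- Exactly the first `m` factors are nonpositive. The inequalities are weak because `z` may itself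
be a root. -/
lemma sign_eval_rootProd {x : ℕ → ℝ} {N m : ℕ} {z : ℝ} (hm : m ≤ N) (hpos : ∀ i < N, 0 < x i)
    (hl : ∀ i < m, x i ≤ z) (hr : ∀ i < N, m ≤ i → z ≤ x i) :
    0 ≤ (-1) ^ m * (rootProd x N).eval z := by
  rw [eval_rootProd, ← prod_range_mul_prod_Ico _ hm, ← mul_assoc]
  refine mul_nonneg ?_ (prod_nonneg fun i hi => ?_)
  · have : ((-1 : ℝ)) ^ m = ∏ _i ∈ range m, (-1 : ℝ) := by simp
    rw [this, ← prod_mul_distrib]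
    refine prod_nonneg fun i hi => ?_
    have hi := mem_range.1 hi
    have h1 : 1 ≤ (x i)⁻¹ * z := by
      rw [inv_mul_eq_div, one_le_div (hpos i (hi.trans_le hm))]
      exact hl i hi
    linarith
  · have hi := mem_Ico.1 hi
    have h1 : (x i)⁻¹ * z ≤ 1 := by
      rw [inv_mul_eq_div, div_le_one (hpos i hi.2)]
      exact hr i hi.2 hi.1
    linarith

/-- `f` has `N` positive roots `x_0 < x_1 < ⋯`, consecutive ones separated by the factor `q`, with
`x_i ≤ q^{-(i+1)}`, and `f(0) = 1`. -/
structure QSeparated (q : ℝ) (N : ℕ) (x : ℕ → ℝ) (f : ℝ[X]) : Prop where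
  pos : ∀ i < N, 0 < x i
  sep : ∀ i j, i < j → j < N → x i ≤ q * x j
  le : ∀ i < N, x i ≤ q⁻¹ ^ (i + 1)
  eq : f = rootProd x N

/-- The operator multiplying the `n`-th coefficient by `(1 - α q^n) / (1 - α)`. -/
def qShift (q α : ℝ) (f : ℝ[X]) : ℝ[X] := C (1 - α)⁻¹ * (f - C α * f.comp (C q * X))

lemma coeff_qShift (q α : ℝ) (f : ℝ[X]) (n : ℕ) :
    (qShift q α f).coeff n = f.coeff n * ((1 - α * q ^ n) / (1 - α)) := by
  rw [qShift, coeff_C_mul, coeff_sub, coeff_C_mul, comp_C_mul_X_coeff]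
  ring

lemma eval_qShift (q α : ℝ) (f : ℝ[X]) (z : ℝ) :
    (qShift q α f).eval z = (1 - α)⁻¹ * (f.eval z - α * f.eval (q * z)) := by
  simp [qShift]

lemma exists_root_of_sign {W : ℝ[X]} {l r : ℝ} (hlr : l ≤ r) (m : ℕ)
    (hl : 0 ≤ (-1) ^ m * W.eval l) (hr : (-1) ^ m * W.eval r ≤ 0) :
    ∃ z, l ≤ z ∧ z ≤ r ∧ W.eval z = 0 := by
  have hc : ContinuousOn (fun z => (-1) ^ m * W.eval z) (Set.Icc l r) := by fun_prop
  obtain ⟨z, hz, h⟩ := intermediate_value_Icc' hlr hc ⟨hr, hl⟩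
  refine ⟨z, hz.1, hz.2, ?_⟩
  simpa using h

/-- Sign changes of `f(z) - α f(qz)`: at `x_i` only `-α f(q x_i)` is left, and at `x_(i-1)/q` only
`f(x_(i-1)/q)`. Separation places both arguments between `x_(i-1)` and `x_i`, so the signs are
opposite and a new root `y_i` lies in `[x_(i-1)/q, x_i]` (in `(0, x_0]` if `i = 0`). Then `y_(i-1) ≤
x_(i-1) ≤ q y_i`, so the separation persists. -/
theorem QSeparated.qShift {q α : ℝ} (hq0 : 0 < q) (hq1 : q < 1) (hα0 : 0 < α) (hα1 : α < 1)
    {N : ℕ} {x : ℕ → ℝ} {f : ℝ[X]} (h : QSeparated q N x f) :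
    ∃ y, QSeparated q N y (qShift q α f) := by
  have hlt : ∀ i j, i < j → j < N → x i < x j := fun i j hij hj =>
    (h.sep i j hij hj).trans_lt (by nlinarith [h.pos j hj])
  have hα : 0 < (1 - α)⁻¹ := inv_pos.2 (by linarith)
  have hex : ∀ i, ∃ z, i < N → (0 < z ∧ (∀ j < i, x j / q ≤ z) ∧ z ≤ x i ∧
      (_root_.qShift q α f).eval z = 0) := by
    intro i
    by_cases hi : i < N
    swap
    · exact ⟨0, fun h => absurd h hi⟩
    have hr : (-1) ^ i * (_root_.qShift q α f).eval (x i) ≤ 0 := by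
      have h0 : f.eval (x i) = 0 := by rw [h.eq]; exact eval_rootProd_root hi (h.pos i hi).ne'
      have h1 : 0 ≤ (-1) ^ i * f.eval (q * x i) := by
        rw [h.eq]
        refine sign_eval_rootProd hi.le h.pos (fun j hj => h.sep j i hj hi) fun j hj hij => ?_
        have h2 : x i ≤ x j := by
          rcases hij.eq_or_lt with rfl | hij
          · exact le_rfl
          · exact (hlt i j hij hj).le
        nlinarith [h.pos i hi]
      rw [eval_qShift, h0]
      have := mul_nonneg (mul_pos hα hα0).le h1
      nlinarith
    rcases i with _ | k
    · have h0 : 0 < (_root_.qShift q α f).eval 0 := by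
        rw [← coeff_zero_eq_eval_zero, coeff_qShift, h.eq, coeff_zero_rootProd]
        simp [sub_ne_zero.2 hα1.ne']
      obtain ⟨z, hz0, hz1, hz⟩ := exists_root_of_sign (h.pos 0 hi).le 0 (by simpa using h0.le) hr
      refine ⟨z, fun _ => ⟨lt_of_le_of_ne hz0 ?_, by simp, hz1, hz⟩⟩
      rintro rfl
      exact h0.ne' hz
    · have hk : k < N := by omega
      have hle : x k / q ≤ x (k + 1) := by
        rw [div_le_iff₀ hq0, mul_comm]
        exact h.sep k (k + 1) (by omega) hi
      have hl : 0 ≤ (-1) ^ (k + 1) * (_root_.qShift q α f).eval (x k / q) := by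
        have h0 : f.eval (x k) = 0 := by rw [h.eq]; exact eval_rootProd_root hk (h.pos k hk).ne'
        have hxk : x k ≤ x k / q := by
          rw [le_div_iff₀ hq0]
          nlinarith [h.pos k hk]
        have h1 : 0 ≤ (-1) ^ (k + 1) * f.eval (x k / q) := by
          rw [h.eq]
          refine sign_eval_rootProd hi.le h.pos (fun j hj => ?_) fun j hj hij => ?_
          · rcases (Nat.lt_succ_iff.1 hj).eq_or_lt with rfl | hj
            · exact hxk
            · exact (hlt j k hj hk).le.trans hxk
          · rcases hij.eq_or_lt with rfl | hij
            · exact hle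
            · exact hle.trans (hlt _ j hij hj).le
        rw [eval_qShift, mul_div_cancel₀ _ hq0.ne', h0]
        have := mul_nonneg hα.le h1
        nlinarith
      obtain ⟨z, hz0, hz1, hz⟩ := exists_root_of_sign hle (k + 1) hl hr
      refine ⟨z, fun _ => ⟨(div_pos (h.pos k hk) hq0).trans_le hz0, fun j hj => ?_, hz1, hz⟩⟩
      refine le_trans ?_ hz0
      rcases (Nat.lt_succ_iff.1 hj).eq_or_lt with rfl | hj
      · exact le_rfl
      · gcongr
        exact (hlt j k hj hk).le
  choose y hy using hex
  have hsep : ∀ i j, i < j → j < N → y i ≤ q * y j := fun i j hij hj => by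
    have h1 := (hy j hj).2.1 i hij
    rw [div_le_iff₀ hq0, mul_comm] at h1
    exact (hy i (hij.trans hj)).2.2.1.trans h1
  refine ⟨y, fun i hi => (hy i hi).1, hsep,
    fun i hi => (hy i hi).2.2.1.trans (h.le i hi), eq_rootProd ?_ ?_ (fun i hi => (hy i hi).1)
      (fun i j hij hj => (hsep i j hij hj).trans_lt (by nlinarith [(hy j hj).1]))
      fun i hi => (hy i hi).2.2.2⟩
  · rw [natDegree_le_iff_coeff_eq_zero]
    intro n hn
    rw [coeff_qShift, coeff_eq_zero_of_natDegree_lt, zero_mul]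
    rw [h.eq]
    exact (natDegree_rootProd_le x N).trans_lt hn
  · rw [coeff_qShift, h.eq, coeff_zero_rootProd]
    simp [sub_ne_zero.2 hα1.ne']

/-- The finite `q`-binomial theorem. -/
lemma coeff_rootProd_geometric {q : ℝ} (hq0 : 0 < q) (hq1 : q < 1) (N n : ℕ) :
    (rootProd (fun i => q⁻¹ ^ (i + 1)) N).coeff n =
      ∏ j ∈ range n, -((q ^ (j + 1) - q ^ (N + 1)) / (1 - q ^ (j + 1))) := by
  induction N generalizing n with
  | zero =>
    rcases n with _ | n
    · simp [rootProd]
    · rw [prod_eq_zero (mem_range.2 n.succ_pos) (by simp)]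
      simp [rootProd, coeff_one]
  | succ N ih =>
    rcases n with _ | n
    · simp [coeff_zero_rootProd]
    -- Since `q^(j+2) - q^(N+2) = q (q^(j+1) - q^(N+1))`, the numerators for `N + 1` are those for
    -- `N` shifted by one index.
    have key : ∀ n, ∏ j ∈ range (n + 1), -((q ^ (j + 1) - q ^ (N + 1 + 1)) / (1 - q ^ (j + 1))) =
        -((q - q ^ (N + 2)) / (1 - q ^ (n + 1)) * q ^ n) *
          ∏ j ∈ range n, -((q ^ (j + 1) - q ^ (N + 1)) / (1 - q ^ (j + 1))) := by
      intro n
      induction n with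
      | zero => simp
      | succ n ih =>
        rw [prod_range_succ, ih, prod_range_succ _ n]
        have h1 : 1 - q ^ (n + 1) ≠ 0 := (sub_pos.2 (pow_lt_one₀ hq0.le hq1 (by omega))).ne'
        have h2 : 1 - q ^ (n + 1 + 1) ≠ 0 := (sub_pos.2 (pow_lt_one₀ hq0.le hq1 (by omega))).ne'
        field_simp
        ring
    rw [coeff_succ_rootProd_succ, ih, ih, key, prod_range_succ, inv_pow, inv_inv]
    have h1 : 1 - q ^ (n + 1) ≠ 0 := (sub_pos.2 (pow_lt_one₀ hq0.le hq1 (by omega))).ne'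
    field_simp
    ring

/-- The approximating polynomials, `K` factors having been applied. -/
def qApprox (a q : ℝ) (N : ℕ) : ℕ → ℝ[X]
  | 0 => rootProd (fun i => q⁻¹ ^ (i + 1)) N
  | K + 1 => qShift q (a * q ^ K) (qApprox a q N K)

lemma coeff_qApprox {a q : ℝ} (hq0 : 0 < q) (hq1 : q < 1) (N K n : ℕ) :
    (qApprox a q N K).coeff n =
      (∏ j ∈ range n, -((q ^ (j + 1) - q ^ (N + 1)) / (1 - q ^ (j + 1)))) *
        ∏ k ∈ range K, (1 - a * q ^ k * q ^ n) / (1 - a * q ^ k) := by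
  induction K with
  | zero => rw [qApprox, coeff_rootProd_geometric hq0 hq1, range_zero, prod_empty, mul_one]
  | succ K ih => rw [qApprox, coeff_qShift, ih, prod_range_succ, mul_assoc]

lemma exists_qSeparated_qApprox {a q : ℝ} (hq0 : 0 < q) (hq1 : q < 1) (ha0 : 0 < a) (ha1 : a < 1)
    (N K : ℕ) : ∃ y, QSeparated q N y (qApprox a q N K) := by
  induction K with
  | zero =>
    refine ⟨fun i => q⁻¹ ^ (i + 1), fun i _ => by positivity, fun i j hij _ => ?_,
      fun _ _ => le_rfl, rfl⟩
    have h1 : q * q⁻¹ ^ (j + 1) = q⁻¹ ^ j := by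
      rw [pow_succ']
      field_simp
    simp only [h1]
    exact pow_le_pow_right₀ (one_le_inv_iff₀.2 ⟨hq0, hq1.le⟩) hij
  | succ K ih =>
    obtain ⟨y, hy⟩ := ih
    refine hy.qShift hq0 hq1 (by positivity) ?_
    calc a * q ^ K ≤ a * 1 := by gcongr; exact pow_le_one₀ hq0.le hq1.le
      _ < 1 := by linarith

end

/-! ### Interlacing, power sums and the logarithmic derivative -/

noncomputable section
open Polynomial Finset

lemma QSeparated.lt {q : ℝ} (hq1 : q < 1) {N : ℕ} {y : ℕ → ℝ} {P : ℝ[X]} (h : QSeparated q N y P)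
    {i j : ℕ} (hij : i < j) (hj : j < N) : y i < y j :=
  (h.sep i j hij hj).trans_lt (by nlinarith [h.pos j hj])

lemma QSeparated.zero_le {q : ℝ} (hq1 : q < 1) {N : ℕ} {y : ℕ → ℝ} {P : ℝ[X]}
    (h : QSeparated q N y P) {i : ℕ} (hi : i < N) : y 0 ≤ y i := by
  rcases i.eq_zero_or_pos with rfl | h0
  · exact le_rfl
  · exact (h.lt hq1 h0 hi).le

lemma coeff_derivative_X_mul (P : ℝ[X]) (n : ℕ) :
    (derivative (X * P)).coeff n = (n + 1) * P.coeff n := by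
  rw [coeff_derivative, coeff_X_mul, mul_comm]

/-- The roots of `(X P)'` interlace with those of `X P`. -/
lemma QSeparated.exists_derivative_roots {q : ℝ} (hq1 : q < 1) {N : ℕ} {y : ℕ → ℝ} {P : ℝ[X]}
    (h : QSeparated q N y P) :
    ∃ x : ℕ → ℝ, (∀ i < N, 0 < x i) ∧ (∀ i < N, x i < y i) ∧ (∀ i, i + 1 < N → y i < x (i + 1)) ∧
      derivative (X * P) = rootProd x N := by
  have hex : ∀ i, ∃ z, i < N → (0 < z ∧ (∀ j < i, y j < z) ∧ z < y i ∧
      (derivative (X * P)).eval z = 0) := by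
    intro i
    by_cases hi : i < N
    swap
    · exact ⟨0, fun h => absurd h hi⟩
    have hyi : ∀ i < N, (X * P).eval (y i) = 0 := fun i hi => by
      rw [eval_mul, h.eq, eval_rootProd_root hi (h.pos i hi).ne', mul_zero]
    -- Rolle on `0, y_0, y_1, …`: the factor `X` supplies the extra zero at `0`, so all `N` roots of
    -- the derivative are found.
    have hr : ∀ l < y i, (X * P).eval l = 0 → ∃ z, l < z ∧ z < y i ∧
        (derivative (X * P)).eval z = 0 := by
      intro l hl hl0
      obtain ⟨z, hz, hz0⟩ := exists_deriv_eq_zero (f := fun z => (X * P).eval z) hl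
        (X * P).continuous.continuousOn (hl0.trans (hyi i hi).symm)
      refine ⟨z, hz.1, hz.2, ?_⟩
      rwa [Polynomial.deriv] at hz0
    rcases i with _ | k
    · obtain ⟨z, h1, h2, h3⟩ := hr 0 (h.pos 0 hi) (by simp)
      exact ⟨z, fun _ => ⟨h1, by simp, h2, h3⟩⟩
    · have hk : k < N := by omega
      obtain ⟨z, h1, h2, h3⟩ := hr (y k) (h.lt hq1 (by omega) hi) (hyi k hk)
      refine ⟨z, fun _ => ⟨(h.pos k hk).trans h1, fun j hj => ?_, h2, h3⟩⟩
      rcases (Nat.lt_succ_iff.1 hj).eq_or_lt with rfl | hj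
      · exact h1
      · exact (h.lt hq1 hj hk).trans h1
  choose x hx using hex
  refine ⟨x, fun i hi => (hx i hi).1, fun i hi => (hx i hi).2.2.1,
    fun i hi => (hx (i + 1) hi).2.1 i (by omega), eq_rootProd ?_ ?_ (fun i hi => (hx i hi).1)
    (fun i j hij hj => (hx i (hij.trans hj)).2.2.1.trans ((hx j hj).2.1 i hij))
    fun i hi => (hx i hi).2.2.2⟩
  · rw [natDegree_le_iff_coeff_eq_zero]
    intro n hn
    rw [coeff_derivative_X_mul, coeff_eq_zero_of_natDegree_lt, mul_zero]
    rw [h.eq]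
    exact (natDegree_rootProd_le y N).trans_lt hn
  · rw [coeff_derivative_X_mul, h.eq, coeff_zero_rootProd]
    simp

/-- The power sums of the reciprocal roots. -/
def recipSum (x : ℕ → ℝ) (N k : ℕ) : ℝ := ∑ i ∈ range N, (x i)⁻¹ ^ k

lemma recipSum_succ (x : ℕ → ℝ) (N k : ℕ) :
    recipSum x (N + 1) k = recipSum x N k + (x N)⁻¹ ^ k := sum_range_succ _ _

/-- Newton's identities, checked by adjoining one factor at a time. -/
lemma recipSum_eq_coeff (x : ℕ → ℝ) (N : ℕ) :
    recipSum x N 1 = -(rootProd x N).coeff 1 ∧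
    recipSum x N 2 = (rootProd x N).coeff 1 ^ 2 - 2 * (rootProd x N).coeff 2 ∧
    recipSum x N 3 = -(rootProd x N).coeff 1 ^ 3
      + 3 * (rootProd x N).coeff 1 * (rootProd x N).coeff 2 - 3 * (rootProd x N).coeff 3 := by
  induction N with
  | zero => simp [recipSum, rootProd, coeff_one]
  | succ N ih =>
    obtain ⟨h1, h2, h3⟩ := ih
    simp only [recipSum_succ, coeff_zero_rootProd, h1, h2, h3,
      show (rootProd x (N + 1)).coeff 1 = _ from coeff_succ_rootProd_succ x N 0,
      show (rootProd x (N + 1)).coeff 2 = _ from coeff_succ_rootProd_succ x N 1,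
      show (rootProd x (N + 1)).coeff 3 = _ from coeff_succ_rootProd_succ x N 2]
    refine ⟨?_, ?_, ?_⟩ <;> ring

/-- The second term is retained so that the inequality stays strict in the limit. -/
lemma le_recipSum {x : ℕ → ℝ} {N : ℕ} (hN : 2 ≤ N) (hpos : ∀ i < N, 0 < x i) (k : ℕ) :
    (x 0)⁻¹ ^ k + (x 1)⁻¹ ^ k ≤ recipSum x N k := by
  have h2 : ∑ i ∈ range 2, (x i)⁻¹ ^ k ≤ recipSum x N k :=
    sum_le_sum_of_subset_of_nonneg (range_mono hN) fun i hi _ => by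
      have := hpos i (mem_range.1 hi)
      positivity
  simpa [sum_range_succ] using h2

/-- The right side is `∑ x_i^(-k) (x_0⁻¹ - x_i⁻¹)`, with nonnegative terms; the term `i = 1` is
retained for strictness in the limit. -/
lemma recipSum_gap {x : ℕ → ℝ} {N : ℕ} (hN : 2 ≤ N) (hpos : ∀ i < N, 0 < x i)
    (hle : ∀ i < N, x 0 ≤ x i) (k : ℕ) :
    (x 1)⁻¹ ^ k * ((x 0)⁻¹ - (x 1)⁻¹) ≤ (x 0)⁻¹ * recipSum x N k - recipSum x N (k + 1) := by
  have h0 : 0 < x 0 := hpos 0 (by omega)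
  rw [recipSum, recipSum, mul_sum, ← sum_sub_distrib]
  have h1 := single_le_sum (f := fun i => (x 0)⁻¹ * (x i)⁻¹ ^ k - (x i)⁻¹ ^ (k + 1))
    (s := range N) (fun i hi => ?_) (mem_range.2 (show 1 < N by omega))
  · refine le_trans (le_of_eq ?_) h1
    ring
  · have hi := mem_range.1 hi
    have h2 := hpos i hi
    have h3 : (x i)⁻¹ ≤ (x 0)⁻¹ := inv_anti₀ h0 (hle i hi)
    have h4 : 0 ≤ (x i)⁻¹ ^ k * ((x 0)⁻¹ - (x i)⁻¹) :=
      mul_nonneg (by positivity) (by linarith)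
    calc (0 : ℝ) ≤ _ := h4
      _ = _ := by ring

/-- From `log (1 - w) ≥ -w/(1 - w)` in each factor. The bound involves only `x 0` and the first
power sum, both of which converge, so the limit function cannot vanish before `ρ`; this replaces
Hurwitz's theorem. -/
lemma exp_le_eval_rootProd {x : ℕ → ℝ} {N : ℕ} (hpos : ∀ i < N, 0 < x i)
    (hle : ∀ i < N, x 0 ≤ x i) (h0 : 0 < x 0) {r : ℝ} (hr0 : 0 ≤ r) (hr : r < x 0) :
    Real.exp (-(recipSum x N 1 * (r / (1 - r / x 0)))) ≤ (rootProd x N).eval r := by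
  rw [eval_rootProd, recipSum, sum_mul, ← sum_neg_distrib, Real.exp_sum]
  refine prod_le_prod (fun _ _ => (Real.exp_pos _).le) fun i hi => ?_
  have hi := mem_range.1 hi
  have hi0 := hpos i hi
  have h1 : (x i)⁻¹ * r ≤ r / x 0 := by
    rw [div_eq_inv_mul]
    exact mul_le_mul_of_nonneg_right (inv_anti₀ h0 (hle i hi)) hr0
  have h2 : r / x 0 < 1 := (div_lt_one h0).2 hr
  have h3 : 0 < 1 - (x i)⁻¹ * r := by linarith
  rw [← Real.le_log_iff_exp_le h3, pow_one]
  refine le_trans ?_ (Real.one_sub_inv_le_log_of_pos h3)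
  have h5 : 0 ≤ (x i)⁻¹ * r := by positivity
  have h4 : (x i)⁻¹ * r / (1 - (x i)⁻¹ * r) ≤ (x i)⁻¹ * r / (1 - r / x 0) := by
    apply div_le_div_of_nonneg_left h5 <;> linarith
  have h6 : 1 - (1 - (x i)⁻¹ * r)⁻¹ = -((x i)⁻¹ * r / (1 - (x i)⁻¹ * r)) := by
    generalize (x i)⁻¹ * r = w at h3
    have h7 := h3.ne'
    field_simp
    ring
  rw [h6, ← mul_div_assoc]
  linarith

lemma aeval_rootProd {K : Type*} [Field K] [Algebra ℝ K] (y : ℕ → ℝ) (N : ℕ) (z : K) :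
    aeval z (rootProd y N) = ∏ i ∈ range N, (1 - algebraMap ℝ K (y i)⁻¹ * z) := by
  simp [rootProd, map_prod]

/-- The logarithmic derivative of `X ∏ (1 - X/y_i)`, over a general field because it is compared at
`z ∈ ℂ` and at `‖z‖ ∈ ℝ`. -/
lemma aeval_derivative_rootProd {K : Type*} [Field K] [Algebra ℝ K] (y : ℕ → ℝ) (N : ℕ) (z : K)
    (hz : ∀ i < N, 1 - algebraMap ℝ K (y i)⁻¹ * z ≠ 0) :
    aeval z (derivative (X * rootProd y N)) = aeval z (rootProd y N) *
      (1 - ∑ i ∈ range N, algebraMap ℝ K (y i)⁻¹ * z / (1 - algebraMap ℝ K (y i)⁻¹ * z)) := by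
  induction N with
  | zero => simp [rootProd]
  | succ N ih =>
    have h1 := hz N N.lt_succ_self
    rw [rootProd_succ, ← mul_assoc, derivative_mul, map_add, map_mul, ih fun i hi => hz i (by omega),
      sum_range_succ]
    simp only [map_mul, derivative_one, derivative_C_mul, derivative_X, mul_one,
      zero_sub, map_neg, aeval_X, aeval_C, map_sub, map_one]
    generalize ∑ i ∈ range N, algebraMap ℝ K (y i)⁻¹ * z / (1 - algebraMap ℝ K (y i)⁻¹ * z) = S
    generalize algebraMap ℝ K (y N)⁻¹ = t at h1
    field_simp
    ring

lemma re_div_one_sub_le {w : ℂ} (hw : ‖w‖ < 1) : (w / (1 - w)).re ≤ ‖w‖ / (1 - ‖w‖) := by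
  refine (Complex.re_le_norm _).trans ?_
  rw [norm_div]
  have h1 : 1 - ‖w‖ ≤ ‖1 - w‖ := by simpa using norm_sub_norm_le (1 : ℂ) w
  exact div_le_div_of_nonneg_left (norm_nonneg _) (by linarith) h1

section Disk
variable {y : ℕ → ℝ} {N : ℕ} {z : ℂ}

lemma norm_inv_mul_lt_one (hpos : ∀ i < N, 0 < y i) (hz : ∀ i < N, ‖z‖ < y i) {i : ℕ}
    (hi : i < N) : ‖algebraMap ℝ ℂ (y i)⁻¹ * z‖ < 1 ∧
      ‖algebraMap ℝ ℂ (y i)⁻¹ * z‖ = (y i)⁻¹ * ‖z‖ := by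
  have h := hpos i hi
  have h1 : ‖algebraMap ℝ ℂ (y i)⁻¹ * z‖ = (y i)⁻¹ * ‖z‖ := by
    rw [norm_mul, norm_algebraMap', Real.norm_of_nonneg (by positivity)]
  refine ⟨?_, h1⟩
  rw [h1, inv_mul_eq_div, div_lt_one h]
  exact hz i hi

lemma eval_norm_le_norm_aeval_rootProd (hpos : ∀ i < N, 0 < y i) (hz : ∀ i < N, ‖z‖ < y i) :
    (rootProd y N).eval ‖z‖ ≤ ‖aeval z (rootProd y N)‖ := by
  rw [eval_rootProd, aeval_rootProd, norm_prod]
  refine prod_le_prod (fun i hi => ?_) fun i hi => ?_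
  · have := norm_inv_mul_lt_one hpos hz (mem_range.1 hi)
    linarith
  · rw [← (norm_inv_mul_lt_one hpos hz (mem_range.1 hi)).2]
    simpa using norm_sub_norm_le (1 : ℂ) (algebraMap ℝ ℂ (y i)⁻¹ * z)

lemma eval_rootProd_norm_pos (hpos : ∀ i < N, 0 < y i) (hz : ∀ i < N, ‖z‖ < y i) :
    0 < (rootProd y N).eval ‖z‖ := by
  rw [eval_rootProd]
  refine prod_pos fun i hi => ?_
  have := norm_inv_mul_lt_one hpos hz (mem_range.1 hi)
  linarith

/-- Apply `re_div_one_sub_le` to each `w = z/y_i` in the logarithmic derivative. -/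
lemma div_le_re_div_rootProd (hpos : ∀ i < N, 0 < y i) (hz : ∀ i < N, ‖z‖ < y i) :
    (derivative (X * rootProd y N)).eval ‖z‖ / (rootProd y N).eval ‖z‖ ≤
      (aeval z (derivative (X * rootProd y N)) / aeval z (rootProd y N)).re := by
  have hP := eval_rootProd_norm_pos hpos hz
  have hPz : aeval z (rootProd y N) ≠ 0 :=
    norm_pos_iff.1 (hP.trans_le (eval_norm_le_norm_aeval_rootProd hpos hz))
  have hb := fun i hi => norm_inv_mul_lt_one hpos hz (i := i) hi
  have hne : ∀ i < N, 1 - algebraMap ℝ ℂ (y i)⁻¹ * z ≠ 0 := fun i hi h => by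
    have h1 := (hb i hi).1
    rw [← sub_eq_zero.1 h] at h1
    simp at h1
  have hneR : ∀ i < N, 1 - algebraMap ℝ ℝ (y i)⁻¹ * ‖z‖ ≠ 0 := fun i hi => by
    have h1 := hb i hi
    simp only [Algebra.algebraMap_self, RingHom.id_apply]
    linarith
  have hR := aeval_derivative_rootProd y N ‖z‖ hneR
  simp only [← Polynomial.coe_aeval_eq_eval]
  rw [hR, aeval_derivative_rootProd y N z hne, mul_div_cancel_left₀ _ hPz,
    mul_div_cancel_left₀ _ (by simpa using hP.ne'), Complex.sub_re, Complex.one_re, Complex.re_sum]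
  refine sub_le_sub_left (sum_le_sum fun i hi => ?_) _
  have h1 := hb i (mem_range.1 hi)
  have h2 := re_div_one_sub_le h1.1
  rwa [h1.2] at h2

end Disk

end

/-! ### Passage to the limit power series -/

noncomputable section
open Polynomial Finset Filter Topology

/-- The sum of the power series with real coefficients `c`. -/
def coeffSum {K : Type*} [RCLike K] (c : ℕ → ℝ) (z : K) : K := ∑' n, algebraMap ℝ K (c n) * z ^ n

lemma ofReal_coeffSum (c : ℕ → ℝ) (r : ℝ) : ((coeffSum c r : ℝ) : ℂ) = coeffSum c (r : ℂ) := by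
  simp [coeffSum, Complex.ofReal_tsum]

lemma coeffSum_zero {K : Type*} [RCLike K] (c : ℕ → ℝ) :
    coeffSum c (0 : K) = algebraMap ℝ K (c 0) := by
  rw [coeffSum, tsum_eq_single 0 fun n hn => by simp [hn]]
  simp

lemma aeval_eq_coeffSum {K : Type*} [RCLike K] (p : ℝ[X]) (z : K) :
    aeval z p = coeffSum p.coeff z := by
  rw [coeffSum, tsum_eq_sum (s := range (p.natDegree + 1)), aeval_eq_sum_range]
  · simp [Algebra.smul_def]
  · intro n hn
    rw [coeff_eq_zero_of_natDegree_lt, map_zero, zero_mul]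
    simpa [Nat.lt_succ_iff] using hn

/-- Dominated convergence. The evaluation point may move, which is what evaluating at the roots of
the approximants requires. -/
lemma tendsto_aeval {K ι : Type*} [RCLike K] {l : Filter ι} {p : ι → ℝ[X]} {c C : ℕ → ℝ}
    (hc : ∀ n, Tendsto (fun i => (p i).coeff n) l (𝓝 (c n))) (hC : ∀ i n, |(p i).coeff n| ≤ C n)
    (hsum : ∀ R : ℝ, Summable fun n => C n * R ^ n) {w : ι → K} {z : K} (hw : Tendsto w l (𝓝 z)) :
    Tendsto (fun i => aeval (w i) (p i)) l (𝓝 (coeffSum c z)) := by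
  simp only [aeval_eq_coeffSum]
  refine tendsto_tsum_of_dominated_convergence (hsum (‖z‖ + 1)) (fun n => ?_) ?_
  · exact (((RCLike.continuous_ofReal (K := K)).tendsto _).comp (hc n)).mul (hw.pow n)
  · filter_upwards [hw.norm.eventually_lt_const (lt_add_one ‖z‖)] with i hi n
    rw [norm_mul, norm_algebraMap', norm_pow, Real.norm_eq_abs]
    gcongr
    · exact (abs_nonneg _).trans (hC i n)
    · exact hC i n

lemma tendsto_eval {ι : Type*} {l : Filter ι} {p : ι → ℝ[X]} {c C : ℕ → ℝ}
    (hc : ∀ n, Tendsto (fun i => (p i).coeff n) l (𝓝 (c n))) (hC : ∀ i n, |(p i).coeff n| ≤ C n)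
    (hsum : ∀ R : ℝ, Summable fun n => C n * R ^ n) {w : ι → ℝ} {z : ℝ} (hw : Tendsto w l (𝓝 z)) :
    Tendsto (fun i => (p i).eval (w i)) l (𝓝 (coeffSum c z)) := by
  simpa only [coe_aeval_eq_eval] using tendsto_aeval hc hC hsum hw

lemma summable_of_summable_succ_mul {C : ℕ → ℝ} (hC : ∀ n, 0 ≤ C n)
    (hsum : ∀ R : ℝ, Summable fun n : ℕ => (n + 1) * C n * R ^ n) (R : ℝ) :
    Summable fun n => C n * R ^ n := by
  refine Summable.of_norm_bounded (hsum |R|) fun n => ?_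
  rw [norm_mul, norm_pow, Real.norm_eq_abs, Real.norm_eq_abs, abs_of_nonneg (hC n)]
  gcongr
  have : 0 ≤ (n : ℝ) * C n := mul_nonneg n.cast_nonneg (hC n)
  linarith

lemma hasDerivAt_mul_coeffSum {K : Type*} [RCLike K] {c C : ℕ → ℝ} (hC : ∀ n, |c n| ≤ C n)
    (hsum : ∀ R : ℝ, Summable fun n : ℕ => (n + 1) * C n * R ^ n) (z : K) :
    HasDerivAt (fun z : K => z * coeffSum c z) (coeffSum (fun n => (n + 1) * c n) z) z := by
  have h0 : (fun z : K => z * coeffSum c z) = fun z => ∑' n, algebraMap ℝ K (c n) * z ^ (n + 1) := by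
    funext z
    rw [coeffSum, ← tsum_mul_left]
    congr 1
    funext n
    ring
  rw [h0]
  refine hasDerivAt_tsum_of_isPreconnected (hsum (‖z‖ + 1)) (t := Metric.ball 0 (‖z‖ + 1))
    Metric.isOpen_ball (convex_ball (0 : K) _).isPreconnected
    (g' := fun n z => algebraMap ℝ K ((n + 1) * c n) * z ^ n) (y₀ := 0) (fun n w _ => ?_)
    (fun n w hw => ?_) (by simp; positivity) (by simp) (by simp)
  · refine ((hasDerivAt_pow (n + 1) w).const_mul (algebraMap ℝ K (c n))).congr_deriv ?_
    rw [map_mul, map_add, map_natCast, map_one, Nat.add_sub_cancel, Nat.cast_succ]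
    ring
  · have hw : ‖w‖ < ‖z‖ + 1 := by simpa using hw
    rw [norm_mul, norm_algebraMap', norm_pow, norm_mul, Real.norm_eq_abs, Real.norm_eq_abs,
      abs_of_nonneg (by positivity : (0 : ℝ) ≤ n + 1)]
    have := (abs_nonneg _).trans (hC n)
    gcongr
    exact hC n

/-- The first positive zero of `∑ (n + 1) c_n z^n`, when `∑ c_n z^n` is a limit of polynomials with
separated positive roots, with the Euler-Rayleigh inequalities. -/
theorem exists_first_zero {q : ℝ} (hq0 : 0 < q) (hq1 : q < 1) {p : ℕ → ℝ[X]} {y : ℕ → ℕ → ℝ}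
    {c C : ℕ → ℝ} (hp : ∀ N, QSeparated q (N + 2) (y N) (p N))
    (hc : ∀ n, Tendsto (fun N => (p N).coeff n) atTop (𝓝 (c n)))
    (hC : ∀ N n, |(p N).coeff n| ≤ C n)
    (hsum : ∀ R : ℝ, Summable fun n : ℕ => (n + 1) * C n * R ^ n)
    {d : ℕ → ℝ} (hd : ∀ n, d n = (n + 1) * c n) :
    ∃ ρ : ℝ, 0 < ρ ∧ coeffSum d ρ = 0 ∧ (∀ r, 0 ≤ r → r < ρ → 0 < coeffSum d r) ∧
      (∀ z : ℂ, ‖z‖ < ρ → 0 < (coeffSum d z / coeffSum c z).re) ∧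
      ρ⁻¹ < -d 1 ∧ ρ⁻¹ ^ 2 < d 1 ^ 2 - 2 * d 2 ∧
      ρ⁻¹ ^ 3 < -d 1 ^ 3 + 3 * d 1 * d 2 - 3 * d 3 ∧
      d 1 ^ 2 - 2 * d 2 < ρ⁻¹ * -d 1 ∧
      -d 1 ^ 3 + 3 * d 1 * d 2 - 3 * d 3 < ρ⁻¹ * (d 1 ^ 2 - 2 * d 2) := by
  have hd' : d = fun n : ℕ => ((n : ℝ) + 1) * c n := funext hd
  have hC0 : ∀ n, 0 ≤ C n := fun n => (abs_nonneg _).trans (hC 0 n)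
  have hcC : ∀ n, |c n| ≤ C n := fun n => le_of_tendsto' (hc n).abs fun N => hC N n
  have hsum0 := summable_of_summable_succ_mul hC0 hsum
  choose x hx0 hxy hyx hQ using fun N => (hp N).exists_derivative_roots hq1
  -- The first roots stay in `[0, q⁻¹]`, so compactness gives a common convergent subsequence.
  have hbox : ∀ N, (x N 0, y N 0) ∈ Set.Icc 0 q⁻¹ ×ˢ Set.Icc 0 q⁻¹ := fun N => by
    have h1 := (hp N).le 0 (by omega)
    have h2 := hxy N 0 (by omega)
    have h3 := hx0 N 0 (by omega)
    simp only [zero_add, pow_one] at h1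
    exact ⟨⟨h3.le, h2.le.trans h1⟩, (h3.trans h2).le, h1⟩
  obtain ⟨⟨ρ, η⟩, hmem, φ, hφ, hlim⟩ :=
    (isCompact_Icc.prod isCompact_Icc).tendsto_subseq hbox
  have hxρ : Tendsto (fun k => x (φ k) 0) atTop (𝓝 ρ) := (continuous_fst.tendsto _).comp hlim
  have hyη : Tendsto (fun k => y (φ k) 0) atTop (𝓝 η) := (continuous_snd.tendsto _).comp hlim
  -- convergence along the subsequence
  have hcP : ∀ n, Tendsto (fun k => (p (φ k)).coeff n) atTop (𝓝 (c n)) := fun n =>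
    (hc n).comp hφ.tendsto_atTop
  have hcQ : ∀ n, Tendsto (fun k => (derivative (X * p (φ k))).coeff n) atTop (𝓝 (d n)) := by
    intro n
    simp only [coeff_derivative_X_mul, hd]
    exact (hcP n).const_mul _
  have hCQ : ∀ k n, |(derivative (X * p (φ k))).coeff n| ≤ (n + 1) * C n := fun k n => by
    rw [coeff_derivative_X_mul, abs_mul, abs_of_nonneg (by positivity : (0 : ℝ) ≤ n + 1)]
    gcongr
    exact hC _ n
  have hd0 : d 0 = 1 := by
    refine tendsto_nhds_unique (hcQ 0) ?_
    simp only [hQ, coeff_zero_rootProd, tendsto_const_nhds_iff]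
  have hρ0 : coeffSum d ρ = 0 := by
    refine tendsto_nhds_unique (tendsto_eval hcQ (fun k => hCQ k) hsum hxρ) ?_
    simp only [hQ, eval_rootProd_root (Nat.succ_pos _) (hx0 _ 0 (Nat.succ_pos _)).ne',
      tendsto_const_nhds_iff]
  have hη0 : coeffSum c η = 0 := by
    refine tendsto_nhds_unique (tendsto_eval hcP (fun k => hC _) hsum0 hyη) ?_
    simp only [(hp _).eq, eval_rootProd_root (Nat.succ_pos _) ((hp _).pos 0 (Nat.succ_pos _)).ne',
      tendsto_const_nhds_iff]
  have hρ : 0 < ρ := by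
    refine lt_of_le_of_ne hmem.1.1 ?_
    rintro rfl
    rw [coeffSum_zero, hd0] at hρ0
    simp at hρ0
  have hρη : ρ ≤ η := le_of_tendsto_of_tendsto' hxρ hyη fun k => (hxy _ 0 (by omega)).le
  have hmono : ∀ N, ∀ i < N + 2, x N 0 ≤ x N i := fun N i hi => by
    rcases i with _ | i
    · exact le_rfl
    · exact ((hxy N 0 (by omega)).le.trans ((hp N).zero_le hq1 (by omega : i < N + 2))).trans
        (hyx N i hi).le
  -- power sums
  have hS : ∀ k, recipSum (x (φ k)) (φ k + 2) 1 = -(derivative (X * p (φ k))).coeff 1 ∧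
      recipSum (x (φ k)) (φ k + 2) 2 = (derivative (X * p (φ k))).coeff 1 ^ 2
        - 2 * (derivative (X * p (φ k))).coeff 2 ∧
      recipSum (x (φ k)) (φ k + 2) 3 = -(derivative (X * p (φ k))).coeff 1 ^ 3
        + 3 * (derivative (X * p (φ k))).coeff 1 * (derivative (X * p (φ k))).coeff 2
        - 3 * (derivative (X * p (φ k))).coeff 3 := fun k => by
    rw [hQ]
    exact recipSum_eq_coeff _ _
  have hS1 : Tendsto (fun k => recipSum (x (φ k)) (φ k + 2) 1) atTop (𝓝 (-d 1)) := by
    simp only [(hS _).1]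
    exact (hcQ 1).neg
  have hS2 : Tendsto (fun k => recipSum (x (φ k)) (φ k + 2) 2) atTop (𝓝 (d 1 ^ 2 - 2 * d 2)) := by
    simp only [(hS _).2.1]
    exact ((hcQ 1).pow 2).sub ((hcQ 2).const_mul 2)
  have hS3 : Tendsto (fun k => recipSum (x (φ k)) (φ k + 2) 3) atTop
      (𝓝 (-d 1 ^ 3 + 3 * d 1 * d 2 - 3 * d 3)) := by
    simp only [(hS _).2.2]
    exact ((((hcQ 1).pow 3).neg).add (((hcQ 1).const_mul 3).mul (hcQ 2))).sub ((hcQ 3).const_mul 3)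
  have hinv : Tendsto (fun k => (x (φ k) 0)⁻¹) atTop (𝓝 ρ⁻¹) := hxρ.inv₀ hρ.ne'
  -- positivity before `ρ`
  have hposQ : ∀ r, 0 ≤ r → r < ρ → 0 < coeffSum d r := by
    intro r hr0 hr
    have hlim : Tendsto (fun k => Real.exp (-(recipSum (x (φ k)) (φ k + 2) 1 *
        (r / (1 - r / x (φ k) 0))))) atTop (𝓝 (Real.exp (-(-d 1 * (r / (1 - r / ρ)))))) := by
      refine (Real.continuous_exp.tendsto _).comp (hS1.mul ?_).neg
      refine tendsto_const_nhds.div (tendsto_const_nhds.sub (tendsto_const_nhds.div hxρ hρ.ne')) ?_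
      exact (sub_pos.2 ((div_lt_one hρ).2 hr)).ne'
    refine (Real.exp_pos _).trans_le (le_of_tendsto_of_tendsto hlim
      (tendsto_eval hcQ (fun k => hCQ k) hsum (tendsto_const_nhds (x := r))) ?_)
    filter_upwards [hxρ.eventually_const_lt hr] with k hk
    rw [hQ]
    exact exp_le_eval_rootProd (hx0 _) (hmono _) (hx0 _ 0 (by omega)) hr0 hk
  have hder : ∀ r : ℝ, HasDerivAt (fun r : ℝ => r * coeffSum c r) (coeffSum d r) r := fun r => by
    rw [hd']
    exact hasDerivAt_mul_coeffSum hcC hsum r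
  have hposP : ∀ r, 0 < r → r ≤ ρ → 0 < coeffSum c r := by
    intro r hr0 hr
    -- `r P(r)` starts at `0` and has derivative `Q(r) > 0` before `ρ`. Thus `P(ρ) > 0`, which
    -- separates `ρ` from the zero `η` of `P`.
    have hm : StrictMonoOn (fun r : ℝ => r * coeffSum c r) (Set.Icc 0 ρ) := by
      refine strictMonoOn_of_deriv_pos (convex_Icc _ _)
        (fun r _ => (hder r).continuousAt.continuousWithinAt) fun r hr => ?_
      rw [interior_Icc] at hr
      rw [(hder r).deriv]
      exact hposQ r hr.1.le hr.2
    have h1 := hm ⟨le_rfl, hρ.le⟩ ⟨hr0.le, hr⟩ hr0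
    simp only [zero_mul] at h1
    exact pos_of_mul_pos_right h1 hr0.le
  have hlt : ρ < η := by
    refine lt_of_le_of_ne hρη ?_
    rintro rfl
    exact (hposP ρ hρ le_rfl).ne' hη0
  have hc0 : c 0 = 1 := by simpa [hd] using hd0
  have hposP0 : ∀ r, 0 ≤ r → r ≤ ρ → 0 < coeffSum c r := fun r hr0 hr => by
    rcases hr0.eq_or_lt with rfl | h
    · rw [coeffSum_zero, hc0]
      simp
    · exact hposP r h hr
  refine ⟨ρ, hρ, hρ0, hposQ, fun z hz => ?_, ?_⟩
  · have hev : ∀ᶠ k in atTop, ∀ i < φ k + 2, ‖z‖ < y (φ k) i := by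
      filter_upwards [hyη.eventually_const_lt (hz.trans hlt)] with k hk i hi
      exact hk.trans_le ((hp _).zero_le hq1 hi)
    have hPz : Tendsto (fun k => aeval z (p (φ k))) atTop (𝓝 (coeffSum c z)) :=
      tendsto_aeval hcP (fun k => hC _) hsum0 tendsto_const_nhds
    have hPr : Tendsto (fun k => (p (φ k)).eval ‖z‖) atTop (𝓝 (coeffSum c ‖z‖)) :=
      tendsto_eval hcP (fun k => hC _) hsum0 tendsto_const_nhds
    have hQz : Tendsto (fun k => aeval z (derivative (X * p (φ k)))) atTop (𝓝 (coeffSum d z)) :=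
      tendsto_aeval hcQ (fun k => hCQ k) hsum tendsto_const_nhds
    have hQr : Tendsto (fun k => (derivative (X * p (φ k))).eval ‖z‖) atTop
        (𝓝 (coeffSum d ‖z‖)) :=
      tendsto_eval hcQ (fun k => hCQ k) hsum tendsto_const_nhds
    have hr := hposP0 ‖z‖ (norm_nonneg _) hz.le
    have hne : coeffSum c z ≠ 0 := by
      refine norm_pos_iff.1 (hr.trans_le (le_of_tendsto_of_tendsto hPr hPz.norm ?_))
      filter_upwards [hev] with k hk
      rw [(hp _).eq]
      exact eval_norm_le_norm_aeval_rootProd (hp _).pos hk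
    refine (div_pos (hposQ ‖z‖ (norm_nonneg _) hz) hr).trans_le
      (le_of_tendsto_of_tendsto (hQr.div hPr hr.ne')
        ((Complex.continuous_re.tendsto _).comp (hQz.div hPz hne)) ?_)
    filter_upwards [hev] with k hk
    simp only [Pi.div_apply, Function.comp_apply]
    rw [(hp _).eq]
    exact div_le_re_div_rootProd (hp _).pos hk
  -- The bound `x_1 < y_1 ≤ q^(-2)` is uniform in `N`, so the contribution of the second root
  -- survives in the limit.
  · have hx1 : ∀ N k, (q ^ 2) ^ k ≤ (x N 1)⁻¹ ^ k := fun N k => by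
      have h1 := hxy N 1 (by omega)
      have h2 := (hp N).le 1 (by omega)
      have h3 := hx0 N 1 (by omega)
      gcongr
      rw [← inv_inv (q ^ 2), ← inv_pow]
      exact inv_anti₀ h3 (h1.le.trans h2)
    have hlow : ∀ (k : ℕ) (S : ℝ),
        Tendsto (fun j => recipSum (x (φ j)) (φ j + 2) k) atTop (𝓝 S) → ρ⁻¹ ^ k < S := by
      intro k S hk
      have hq : 0 < (q ^ 2) ^ k := by positivity
      refine (lt_add_of_pos_right _ hq).trans_le
        (le_of_tendsto_of_tendsto' ((hinv.pow k).add_const _) hk fun j => ?_)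
      exact (add_le_add_right (hx1 _ k) _).trans (le_recipSum (by omega) (hx0 _) k)
    have hgap : ∀ (k : ℕ) (S S' : ℝ),
        Tendsto (fun j => recipSum (x (φ j)) (φ j + 2) k) atTop (𝓝 S) →
        Tendsto (fun j => recipSum (x (φ j)) (φ j + 2) (k + 1)) atTop (𝓝 S') → S' < ρ⁻¹ * S := by
      intro k S S' hk hk'
      -- As `x_1 > y_0` and `y_0 → η`, the retained gap `x_0⁻¹ - x_1⁻¹` is at least `ρ⁻¹ - η⁻¹ > 0`
      -- in the limit.
      have hq : 0 < (q ^ 2) ^ k * (ρ⁻¹ - η⁻¹) :=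
        mul_pos (by positivity) (sub_pos.2 (inv_strictAnti₀ hρ hlt))
      rw [← sub_pos]
      refine hq.trans_le (le_of_tendsto_of_tendsto'
        ((hinv.sub (hyη.inv₀ (hρ.trans hlt).ne')).const_mul _) ((hinv.mul hk).sub hk') fun j => ?_)
      refine le_trans ?_ (recipSum_gap (by omega) (hx0 _) (hmono _) k)
      have h1 := hyx (φ j) 0 (by omega)
      have h2 := (hx0 (φ j) 0 (by omega)).trans (hxy (φ j) 0 (by omega))
      have h3 : (x (φ j) (0 + 1))⁻¹ ≤ (y (φ j) 0)⁻¹ := inv_anti₀ h2 h1.le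
      have h4 : (y (φ j) 0)⁻¹ ≤ (x (φ j) 0)⁻¹ :=
        inv_anti₀ (hx0 _ 0 (by omega)) (hxy _ 0 (by omega)).le
      refine mul_le_mul (hx1 _ k) (sub_le_sub_left h3 _) (by linarith) ?_
      exact le_trans (by positivity) (hx1 _ k)
    exact ⟨by simpa using hlow 1 _ hS1, hlow 2 _ hS2, hlow 3 _ hS3, hgap 1 _ _ hS1 hS2,
      hgap 2 _ _ hS2 hS3⟩

end

/-! ### The Hahn-Exton series and its approximants -/

noncomputable section
open Polynomial Finset Filter Topology

lemma qPoch_pos {a q : ℝ} (hq0 : 0 < q) (hq1 : q < 1) (ha0 : 0 < a) (ha1 : a < 1) (n : ℕ) :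
    0 < qPoch a q n :=
  prod_pos fun k _ => by
    have : q ^ k ≤ 1 := pow_le_one₀ hq0.le hq1.le
    nlinarith

lemma qPochInf_ne_zero {a q : ℝ} (hq0 : 0 < q) (hq1 : q < 1) (ha0 : 0 < a) (ha1 : a < 1) :
    qPochInf a q ≠ 0 := by
  have h := tprod_one_add_ne_zero_of_summable (f := fun k : ℕ => -(a * q ^ k)) (fun k => ?_) ?_
  · simpa only [qPochInf, sub_eq_add_neg] using h
  · have : q ^ k ≤ 1 := pow_le_one₀ hq0.le hq1.le
    nlinarith
  · simp only [norm_neg]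
    exact ((summable_geometric_of_lt_one hq0.le hq1).mul_left a).norm

lemma triangle_succ (n : ℕ) : (n + 1) * (n + 1 + 1) / 2 = n * (n + 1) / 2 + (n + 1) := by
  rw [show (n + 1) * (n + 1 + 1) = n * (n + 1) + 2 * (n + 1) by ring, Nat.add_mul_div_left _ _ two_pos]

/-- The coefficients of `c_ν(q) z^{-ν/2} J_ν^{(3)}(√z; q)`, with `a = q^{ν+1}`. -/
def hahnExtonCoeff (a q : ℝ) (n : ℕ) : ℝ :=
  (-1) ^ n * q ^ (n * (n + 1) / 2) / (qPoch q q n * qPoch a q n)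

lemma prod_neg_div_eq (q : ℝ) (n : ℕ) : ∏ j ∈ range n, -(q ^ (j + 1) / (1 - q ^ (j + 1))) =
    (-1) ^ n * q ^ (n * (n + 1) / 2) / qPoch q q n := by
  induction n with
  | zero => simp [qPoch]
  | succ n ih =>
    rw [prod_range_succ, ih, qPoch, qPoch, prod_range_succ _ n, triangle_succ, ← pow_succ' q n,
      pow_add q, pow_succ (-1 : ℝ), ← neg_div, div_mul_div_comm]
    congr 1
    ring

/-- After cross-multiplication both sides are `(a;q)_(K+n)`, split after `n` or after `K` factors.
Only `n` factors then depend on `K`, and each tends to `1`. -/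
lemma prod_shift_eq {a q : ℝ} (hq0 : 0 < q) (hq1 : q < 1) (ha0 : 0 < a) (ha1 : a < 1) (K n : ℕ) :
    ∏ k ∈ range K, (1 - a * q ^ k * q ^ n) / (1 - a * q ^ k) =
      (∏ j ∈ range n, (1 - a * q ^ (K + j))) / qPoch a q n := by
  rw [prod_div_distrib, ← qPoch, div_eq_div_iff (qPoch_pos hq0 hq1 ha0 ha1 K).ne'
    (qPoch_pos hq0 hq1 ha0 ha1 n).ne']
  have h1 := prod_range_add (fun k => 1 - a * q ^ k) n K
  have h2 := prod_range_add (fun k => 1 - a * q ^ k) K n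
  rw [add_comm n K, h2] at h1
  rw [qPoch, qPoch, mul_comm, mul_comm (∏ j ∈ range n, (1 - a * q ^ (K + j))), h1]
  congr 1
  refine prod_congr rfl fun k _ => ?_
  ring

lemma coeff_qApprox_eq {a q : ℝ} (hq0 : 0 < q) (hq1 : q < 1) (ha0 : 0 < a) (ha1 : a < 1)
    (N n : ℕ) : (qApprox a q N N).coeff n =
      (∏ j ∈ range n, -((q ^ (j + 1) - q ^ (N + 1)) / (1 - q ^ (j + 1)))) *
        ((∏ j ∈ range n, (1 - a * q ^ (N + j))) / qPoch a q n) := by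
  rw [coeff_qApprox hq0 hq1, prod_shift_eq hq0 hq1 ha0 ha1]

lemma hahnExtonCoeff_eq (a q : ℝ) (n : ℕ) : hahnExtonCoeff a q n =
    (∏ j ∈ range n, -(q ^ (j + 1) / (1 - q ^ (j + 1)))) * (1 / qPoch a q n) := by
  rw [prod_neg_div_eq, hahnExtonCoeff, div_mul_div_comm, mul_one]

lemma tendsto_coeff_qApprox {a q : ℝ} (hq0 : 0 < q) (hq1 : q < 1) (ha0 : 0 < a) (ha1 : a < 1)
    (n : ℕ) :
    Tendsto (fun N => (qApprox a q N N).coeff n) atTop (𝓝 (hahnExtonCoeff a q n)) := by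
  have hq := tendsto_pow_atTop_nhds_zero_of_lt_one hq0.le hq1
  simp only [coeff_qApprox_eq hq0 hq1 ha0 ha1, hahnExtonCoeff_eq]
  refine Tendsto.mul (tendsto_finsetProd _ fun j _ => ?_) (Tendsto.div_const ?_ _)
  · have h1 := (((tendsto_add_atTop_iff_nat 1).2 hq).const_sub (q ^ (j + 1))).div_const
      (1 - q ^ (j + 1))
    rw [sub_zero] at h1
    exact h1.neg
  · have h1 : (1 : ℝ) = ∏ j ∈ range n, (1 : ℝ) := by simp
    rw [h1]
    refine tendsto_finsetProd _ fun j _ => ?_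
    have h2 := (((tendsto_add_atTop_iff_nat j).2 hq).const_mul a).const_sub 1
    simpa using h2

/-- The limit coefficients themselves dominate: subtracting `q^(N+1)` shrinks each numerator when `n
≤ N`, a factor vanishes when `n > N`, and the remaining factors lie in `[0, 1]`. -/
lemma abs_coeff_qApprox_le {a q : ℝ} (hq0 : 0 < q) (hq1 : q < 1) (ha0 : 0 < a) (ha1 : a < 1)
    (N n : ℕ) : |(qApprox a q N N).coeff n| ≤ |hahnExtonCoeff a q n| := by
  rw [coeff_qApprox_eq hq0 hq1 ha0 ha1, hahnExtonCoeff_eq, abs_mul, abs_mul, abs_prod, abs_prod,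
    abs_div, abs_div, abs_one]
  refine mul_le_mul ?_ ?_ (by positivity) (prod_nonneg fun _ _ => abs_nonneg _)
  · by_cases hn : n ≤ N
    · refine prod_le_prod (fun _ _ => abs_nonneg _) fun j hj => ?_
      have hj := mem_range.1 hj
      rw [abs_neg, abs_neg, abs_div, abs_div]
      have h1 : q ^ (N + 1) ≤ q ^ (j + 1) := pow_le_pow_of_le_one hq0.le hq1.le (by omega)
      have h2 : 0 < q ^ (N + 1) := by positivity
      refine div_le_div_of_nonneg_right ?_ (abs_nonneg _)
      rw [abs_of_nonneg (by linarith), abs_of_nonneg (by positivity)]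
      linarith
    · rw [prod_eq_zero (mem_range.2 (not_le.1 hn)) (by simp)]
      exact prod_nonneg fun _ _ => abs_nonneg _
  · gcongr
    rw [abs_prod]
    refine prod_le_one (fun _ _ => abs_nonneg _) fun j _ => ?_
    have h1 : q ^ (N + j) ≤ 1 := pow_le_one₀ hq0.le hq1.le
    have h2 : 0 < q ^ (N + j) := by positivity
    rw [abs_le]
    constructor <;> nlinarith

lemma hahnExtonCoeff_succ (a q : ℝ) (n : ℕ) : hahnExtonCoeff a q (n + 1) =
    hahnExtonCoeff a q n * -(q ^ (n + 1) / ((1 - q ^ (n + 1)) * (1 - a * q ^ n))) := by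
  rw [hahnExtonCoeff_eq, hahnExtonCoeff_eq, prod_range_succ, qPoch, qPoch, prod_range_succ _ n]
  generalize ∏ x ∈ range n, (1 - a * q ^ x) = A
  generalize 1 - a * q ^ n = B
  generalize 1 - q ^ (n + 1) = D
  rw [div_eq_mul_inv, div_eq_mul_inv, div_eq_mul_inv, div_eq_mul_inv, mul_inv, mul_inv]
  ring

lemma summable_hahnExtonCoeff {a q : ℝ} (hq0 : 0 < q) (hq1 : q < 1) (ha0 : 0 < a) (ha1 : a < 1)
    (R : ℝ) : Summable fun n : ℕ => (n + 1) * |hahnExtonCoeff a q n| * R ^ n := by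
  have h1 : Tendsto (fun n : ℕ => 2 * |R| / ((1 - q) * (1 - a)) * q ^ (n + 1)) atTop (𝓝 0) := by
    have := ((tendsto_add_atTop_iff_nat 1).2
      (tendsto_pow_atTop_nhds_zero_of_lt_one hq0.le hq1)).const_mul (2 * |R| / ((1 - q) * (1 - a)))
    rwa [mul_zero] at this
  refine summable_of_ratio_norm_eventually_le (r := 1 / 2) (by norm_num) ?_
  filter_upwards [h1.eventually_lt_const (show (0 : ℝ) < 1 / 2 by norm_num)] with n hn
  have hqn : q ^ (n + 1) ≤ q := pow_le_of_le_one hq0.le hq1.le (by omega)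
  have hqn' : q ^ n ≤ 1 := pow_le_one₀ hq0.le hq1.le
  have hden : (1 - q) * (1 - a) ≤ (1 - q ^ (n + 1)) * (1 - a * q ^ n) := by
    apply mul_le_mul <;> nlinarith
  have hden0 : 0 < (1 - q) * (1 - a) := mul_pos (by linarith) (by linarith)
  rw [hahnExtonCoeff_succ, abs_mul, abs_neg,
    abs_of_nonneg (div_nonneg (by positivity) (hden0.le.trans hden))]
  simp only [norm_mul, norm_pow, Real.norm_eq_abs, abs_abs, abs_of_nonneg (by positivity : (0 : ℝ) ≤ n + 1),
    abs_of_nonneg (by positivity : (0 : ℝ) ≤ (n + 1 : ℕ) + 1)]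
  rw [abs_of_nonneg (div_nonneg (by positivity) (hden0.le.trans hden))]
  have h2 : q ^ (n + 1) / ((1 - q ^ (n + 1)) * (1 - a * q ^ n)) ≤ q ^ (n + 1) / ((1 - q) * (1 - a)) := by
    gcongr
  have h3 : ((n + 1 : ℕ) : ℝ) + 1 ≤ 2 * (n + 1) := by
    push_cast
    linarith [n.cast_nonneg (α := ℝ)]
  calc ((n + 1 : ℕ) + 1 : ℝ) * (|hahnExtonCoeff a q n| *
        (q ^ (n + 1) / ((1 - q ^ (n + 1)) * (1 - a * q ^ n)))) * |R| ^ (n + 1)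
      ≤ (2 * (n + 1)) * (|hahnExtonCoeff a q n| *
        (q ^ (n + 1) / ((1 - q) * (1 - a)))) * |R| ^ (n + 1) := by
        have : 0 ≤ q ^ (n + 1) / ((1 - q ^ (n + 1)) * (1 - a * q ^ n)) :=
          div_nonneg (by positivity) (hden0.le.trans hden)
        gcongr
    _ = (2 * |R| / ((1 - q) * (1 - a)) * q ^ (n + 1)) *
        ((n + 1) * |hahnExtonCoeff a q n| * |R| ^ n) := by ring
    _ ≤ 1 / 2 * ((n + 1) * |hahnExtonCoeff a q n| * |R| ^ n) := by gcongr

lemma hahnExton_eq (ν q : ℝ) {z : ℂ} (hz : z ≠ 0) :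
    hahnExton ν q z = ((qPochInf (q ^ (ν + 1)) q / qPochInf q q : ℝ) : ℂ) *
      (z ^ (ν : ℂ) * coeffSum (hahnExtonCoeff (q ^ (ν + 1)) q) (z ^ 2)) := by
  rw [hahnExton, coeffSum, ← tsum_mul_left (a := z ^ (ν : ℂ))]
  congr 2
  funext n
  have h1 : z ^ (2 * (n : ℂ) + (ν : ℂ)) = z ^ (ν : ℂ) * (z ^ 2) ^ n := by
    rw [Complex.cpow_add _ _ hz, ← pow_mul, ← Complex.cpow_natCast]
    push_cast
    ring
  rw [h1, hahnExtonCoeff]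
  simp only [Complex.coe_algebraMap]
  push_cast
  ring

lemma hNorm_eq {ν q : ℝ} (hν : -1 < ν) (hq0 : 0 < q) (hq1 : q < 1) :
    hNorm ν q = fun z => z * coeffSum (hahnExtonCoeff (q ^ (ν + 1)) q) z := by
  have ha1 : q ^ (ν + 1) < 1 := Real.rpow_lt_one hq0.le hq1 (by linarith)
  have ha0 : 0 < q ^ (ν + 1) := Real.rpow_pos_of_pos hq0 _
  have h1 := qPochInf_ne_zero hq0 hq1 ha0 ha1
  have h2 := qPochInf_ne_zero hq0 hq1 hq0 hq1
  funext z
  by_cases hz : z = 0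
  · subst hz
    rw [zero_mul, hNorm]
    -- For `ν = 2` the outer power is `0 ^ 0 = 1`, and it is the series that vanishes at the origin.
    by_cases h : (1 : ℂ) - ν / 2 = 0
    · have hν2 : (ν : ℂ) = 2 := by linear_combination -2 * h
      have h3 : hahnExton ν q ((0 : ℂ) ^ (1 / 2 : ℂ)) = 0 := by
        have h4 : ∀ n : ℕ, (0 : ℂ) ^ (2 * (n : ℂ) + 2) = 0 := fun n =>
          Complex.zero_cpow (by norm_cast)
        rw [hahnExton, Complex.zero_cpow (by norm_num), hν2]
        simp [h4]
      rw [h3, mul_zero]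
    · rw [Complex.zero_cpow h, mul_zero, zero_mul]
  · have hs : z ^ (1 / 2 : ℂ) ≠ 0 := by simp [Complex.cpow_eq_zero_iff, hz]
    have hsq : (z ^ (1 / 2 : ℂ)) ^ 2 = z := by
      simp
    have hsν : (z ^ (1 / 2 : ℂ)) ^ (ν : ℂ) = z ^ ((ν : ℂ) / 2) := by
      -- Half the argument stays in `(-π, π]`, so the principal powers compose.
      have him : (Complex.log z * (1 / 2)).im = z.arg / 2 := by
        rw [show (1 / 2 : ℂ) = ((1 / 2 : ℝ) : ℂ) by norm_num, Complex.im_mul_ofReal, Complex.log_im]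
        ring
      rw [← Complex.cpow_mul]
      · congr 1
        ring
      · rw [him]
        linarith [Complex.neg_pi_lt_arg z, Real.pi_pos]
      · rw [him]
        linarith [Complex.arg_le_pi z, Real.pi_pos]
    have hzz : z ^ (1 - (ν : ℂ) / 2) * z ^ ((ν : ℂ) / 2) = z := by
      rw [← Complex.cpow_add _ _ hz, sub_add_cancel, Complex.cpow_one]
    have hc : (cNorm ν q : ℂ) * ((qPochInf (q ^ (ν + 1)) q / qPochInf q q : ℝ) : ℂ) = 1 := by
      rw [cNorm, ← Complex.ofReal_mul, div_mul_div_cancel₀ h1, div_self h2, Complex.ofReal_one]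
    rw [hNorm, hahnExton_eq ν q hs, hsq, hsν]
    linear_combination (z ^ (1 - (ν : ℂ) / 2) * z ^ ((ν : ℂ) / 2) *
      coeffSum (hahnExtonCoeff (q ^ (ν + 1)) q) z) * hc +
      coeffSum (hahnExtonCoeff (q ^ (ν + 1)) q) z * hzz

/-- The coefficients of the derivative of the normalized function. -/
def hNormDerivCoeff (a q : ℝ) (n : ℕ) : ℝ := (n + 1) * hahnExtonCoeff a q n

lemma hasDerivAt_mul_hahnExtonSum {a q : ℝ} (hq0 : 0 < q) (hq1 : q < 1) (ha0 : 0 < a) (ha1 : a < 1)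
    (z : ℂ) : HasDerivAt (fun z : ℂ => z * coeffSum (hahnExtonCoeff a q) z)
      (coeffSum (hNormDerivCoeff a q) z) z :=
  hasDerivAt_mul_coeffSum (fun _ => le_rfl) (summable_hahnExtonCoeff hq0 hq1 ha0 ha1) z

/-- Write `J(z) = κ z^(ν-2) G(z²)` with `G(z) = z P(z)`. In the product rule the term `(ν-2) J`
cancels and only `G'(s²)` remains. -/
lemma hahnExton_equation {ν q : ℝ} (hν : -1 < ν) (hq0 : 0 < q) (hq1 : q < 1) {s : ℝ} (hs : 0 < s) :
    (s : ℂ) * deriv (hahnExton ν q) (s : ℂ) - ((ν : ℂ) - 2) * hahnExton ν q (s : ℂ) =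
      2 * ((qPochInf (q ^ (ν + 1)) q / qPochInf q q : ℝ) : ℂ) * (s : ℂ) ^ (ν : ℂ) *
        coeffSum (hNormDerivCoeff (q ^ (ν + 1)) q) ((s : ℂ) ^ 2) := by
  have ha1 : q ^ (ν + 1) < 1 := Real.rpow_lt_one hq0.le hq1 (by linarith)
  have ha0 : 0 < q ^ (ν + 1) := Real.rpow_pos_of_pos hq0 _
  have hs0 : (s : ℂ) ≠ 0 := by exact_mod_cast hs.ne'
  set κ : ℂ := ((qPochInf (q ^ (ν + 1)) q / qPochInf q q : ℝ) : ℂ)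
  set G : ℂ → ℂ := fun z => z * coeffSum (hahnExtonCoeff (q ^ (ν + 1)) q) z with hG
  have heq : ∀ z : ℂ, z ≠ 0 → hahnExton ν q z = κ * (z ^ ((ν : ℂ) - 2) * G (z ^ 2)) := by
    intro z hz
    have h2 : z ^ ((ν : ℂ) - 2) * z ^ 2 = z ^ (ν : ℂ) := by
      rw [← Complex.cpow_ofNat, ← Complex.cpow_add _ _ hz, sub_add_cancel]
    rw [hahnExton_eq ν q hz, ← h2, hG]
    ring
  have hGd : HasDerivAt G (coeffSum (hNormDerivCoeff (q ^ (ν + 1)) q) ((s : ℂ) ^ 2)) ((s : ℂ) ^ 2) :=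
    hasDerivAt_mul_hahnExtonSum hq0 hq1 ha0 ha1 _
  have hd1 : HasDerivAt (fun z : ℂ => G (z ^ 2))
      (coeffSum (hNormDerivCoeff (q ^ (ν + 1)) q) ((s : ℂ) ^ 2) * (2 * s)) (s : ℂ) := by
    refine (hGd.comp (s : ℂ) (hasDerivAt_pow 2 (s : ℂ))).congr_deriv ?_
    simp
  have hd2 : HasDerivAt (fun z : ℂ => z ^ ((ν : ℂ) - 2))
      (((ν : ℂ) - 2) * (s : ℂ) ^ ((ν : ℂ) - 2 - 1)) (s : ℂ) := by
    simpa using (hasDerivAt_id (s : ℂ)).cpow_const (c := (ν : ℂ) - 2)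
      (Complex.ofReal_mem_slitPlane.2 hs)
  have hd := ((hd2.mul hd1).const_mul κ).congr_of_eventuallyEq
    ((eventually_ne_nhds hs0).mono fun z hz => heq z hz)
  have h3 : (s : ℂ) ^ ((ν : ℂ) - 2 - 1) * s = (s : ℂ) ^ ((ν : ℂ) - 2) := by
    nth_rw 2 [← Complex.cpow_one (s : ℂ)]
    rw [← Complex.cpow_add _ _ hs0, sub_add_cancel]
  have h4 : (s : ℂ) ^ (ν : ℂ) = (s : ℂ) ^ ((ν : ℂ) - 2) * (s : ℂ) ^ 2 := by
    rw [← Complex.cpow_ofNat, ← Complex.cpow_add _ _ hs0, sub_add_cancel]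
  rw [hd.deriv, heq _ hs0, h4]
  linear_combination κ * ((ν : ℂ) - 2) * G ((s : ℂ) ^ 2) * h3

end

/-! ### The radius of starlikeness and the explicit bounds -/

section
open Polynomial Finset Filter Topology

lemma starlikenessRadius_eq {ν q ρ : ℝ} (hν : -1 < ν) (hq0 : 0 < q) (hq1 : q < 1) (hρ : 0 < ρ)
    (h0 : coeffSum (hNormDerivCoeff (q ^ (ν + 1)) q) ρ = 0)
    (hre : ∀ z : ℂ, ‖z‖ < ρ → 0 < (coeffSum (hNormDerivCoeff (q ^ (ν + 1)) q) z /
      coeffSum (hahnExtonCoeff (q ^ (ν + 1)) q) z).re) :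
    starlikenessRadius (hNorm ν q) = ρ := by
  have ha1 : q ^ (ν + 1) < 1 := Real.rpow_lt_one hq0.le hq1 (by linarith)
  have ha0 : 0 < q ^ (ν + 1) := Real.rpow_pos_of_pos hq0 _
  have hder := hasDerivAt_mul_hahnExtonSum hq0 hq1 ha0 ha1
  rw [starlikenessRadius, hNorm_eq hν hq0 hq1]
  refine IsGreatest.csSup_eq ⟨⟨hρ, fun z _ => (hder z).differentiableAt.differentiableWithinAt,
    fun z hz hz0 => ?_⟩, ?_⟩
  · rw [(hder z).deriv, mul_div_mul_left _ _ hz0]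
    exact hre z (by simpa using hz)
  -- A larger disk contains `ρ` itself, where the quotient is `0`.
  · rintro r ⟨_, _, h⟩
    by_contra! hr
    have h1 := h (ρ : ℂ) (by simpa [abs_of_pos hρ] using hr) (by exact_mod_cast hρ.ne')
    rw [(hder _).deriv, ← ofReal_coeffSum, h0] at h1
    simp at h1

lemma hahnExton_equation_iff {ν q r : ℝ} (hν : -1 < ν) (hq0 : 0 < q) (hq1 : q < 1) (hr : 0 < r) :
    ((√r : ℝ) : ℂ) * deriv (hahnExton ν q) ((√r : ℝ) : ℂ)
      - ((ν : ℂ) - 2) * hahnExton ν q ((√r : ℝ) : ℂ) = 0 ↔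
    coeffSum (hNormDerivCoeff (q ^ (ν + 1)) q) r = 0 := by
  have ha1 : q ^ (ν + 1) < 1 := Real.rpow_lt_one hq0.le hq1 (by linarith)
  have ha0 : 0 < q ^ (ν + 1) := Real.rpow_pos_of_pos hq0 _
  have hs := Real.sqrt_pos.2 hr
  have hs0 : ((√r : ℝ) : ℂ) ≠ 0 := by exact_mod_cast hs.ne'
  have hκ : ((qPochInf (q ^ (ν + 1)) q / qPochInf q q : ℝ) : ℂ) ≠ 0 := by
    exact_mod_cast div_ne_zero (qPochInf_ne_zero hq0 hq1 ha0 ha1) (qPochInf_ne_zero hq0 hq1 hq0 hq1)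
  rw [hahnExton_equation hν hq0 hq1 hs, ← Complex.ofReal_pow, Real.sq_sqrt hr.le, ← ofReal_coeffSum]
  simp only [mul_eq_zero, hκ, Complex.cpow_eq_zero_iff, hs0, Complex.ofReal_eq_zero]
  simp

/-- The Euler-Rayleigh inequalities in terms of `a = q^{ν+1}`. -/
lemma bounds_of_power_sums {a q ρ : ℝ} (hq0 : 0 < q) (hq1 : q < 1) (ha1 : a < 1)
    (hρ : 0 < ρ) {d : ℕ → ℝ} (hd : d = hNormDerivCoeff a q) (h1 : ρ⁻¹ < -d 1)
    (h2 : ρ⁻¹ ^ 2 < d 1 ^ 2 - 2 * d 2) (h3 : ρ⁻¹ ^ 3 < -d 1 ^ 3 + 3 * d 1 * d 2 - 3 * d 3)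
    (h4 : d 1 ^ 2 - 2 * d 2 < ρ⁻¹ * -d 1)
    (h5 : -d 1 ^ 3 + 3 * d 1 * d 2 - 3 * d 3 < ρ⁻¹ * (d 1 ^ 2 - 2 * d 2)) :
    (1 - q) * (1 - a) / (2 * q) < ρ ∧
    ρ < (q ^ 2 - 1) * (a - 1) * (a * q - 1) / (q * (q - a * q + 2 * (a * q ^ 2) - 2)) ∧
    (q - 1) * (a - 1) / (2 * q) *
      √(2 * (a * q - 1) * (q + 1) / (q - a * q + 2 * (a * q ^ 2) - 2)) < ρ ∧
    ρ < (a - 1) * (a * q ^ 2 - 1) * (1 - q) / (q * (q + 1)) *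
      ((q - a * q + 2 * (a * q ^ 2) - 2) * (q ^ 3 + 2 * q ^ 2 + 2 * q + 1) /
        (q + q ^ 2 - q ^ 3 - 4 - 5 * (a * q) + 3 * (a * q ^ 2) + 10 * (a * q ^ 3)
          + 3 * (a * q ^ 4) - 5 * (a * q ^ 5) - a ^ 2 * q ^ 3 + a ^ 2 * q ^ 4
          + a ^ 2 * q ^ 5 - 4 * (a ^ 2 * q ^ 6))) := by
  have hρi : 0 < ρ⁻¹ := inv_pos.2 hρ
  have e1 : 0 < 1 - q := by linarith
  have e2 : 0 < 1 - a := by linarith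
  have e3 : 0 < 1 - a * q := by nlinarith
  have e4 : 0 < 1 - a * q ^ 2 := by nlinarith
  have e3' : 1 - q * a ≠ 0 := (mul_comm a q ▸ e3).ne'
  have e4' : 1 - q ^ 2 * a ≠ 0 := (mul_comm a (q ^ 2) ▸ e4).ne'
  have e5 : 0 < 1 + q := by linarith
  have e6 : 0 < 1 + q + q ^ 2 := by positivity
  have c1 : hahnExtonCoeff a q 1 = -q / ((1 - q) * (1 - a)) := by
    simp [hahnExtonCoeff, qPoch]
  have c2 : hahnExtonCoeff a q 2 =
      q ^ 3 / ((1 - q) * ((1 - q) * (1 + q)) * ((1 - a) * (1 - a * q))) := by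
    simp [hahnExtonCoeff, qPoch, prod_range_succ]
    ring
  have c3 : hahnExtonCoeff a q 3 = -q ^ 6 / ((1 - q) * ((1 - q) * (1 + q)) *
      ((1 - q) * (1 + q + q ^ 2)) * ((1 - a) * (1 - a * q) * (1 - a * q ^ 2))) := by
    simp [hahnExtonCoeff, qPoch, prod_range_succ]
    ring
  set D := q - a * q + 2 * (a * q ^ 2) - 2 with hD
  set E := q + q ^ 2 - q ^ 3 - 4 - 5 * (a * q) + 3 * (a * q ^ 2) + 10 * (a * q ^ 3)
    + 3 * (a * q ^ 4) - 5 * (a * q ^ 5) - a ^ 2 * q ^ 3 + a ^ 2 * q ^ 4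
    + a ^ 2 * q ^ 5 - 4 * (a ^ 2 * q ^ 6) with hE
  have s1 : -d 1 = 2 * q / ((1 - q) * (1 - a)) := by
    rw [hd, hNormDerivCoeff, c1]
    push_cast
    ring
  have s2 : d 1 ^ 2 - 2 * d 2 =
      -(2 * q ^ 2 * D) / ((1 - q) ^ 2 * (1 - a) ^ 2 * (1 + q) * (1 - a * q)) := by
    rw [hd, hNormDerivCoeff, hNormDerivCoeff, c1, c2, hD]
    push_cast
    field_simp
    ring
  have s3 : -d 1 ^ 3 + 3 * d 1 * d 2 - 3 * d 3 = -(2 * q ^ 3 * E) / ((1 - q) ^ 3 * (1 - a) ^ 3 *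
      (1 - a * q) * (1 - a * q ^ 2) * ((1 + q) * (1 + q + q ^ 2))) := by
    rw [hd, hNormDerivCoeff, hNormDerivCoeff, hNormDerivCoeff, c1, c2, c3, hE]
    push_cast
    field_simp
    ring
  -- Positivity of the power sums, known from the lower bounds, shows that the denominators `D` and
  -- `E` do not vanish.
  have p1 : 0 < -d 1 := hρi.trans h1
  have p2 : 0 < d 1 ^ 2 - 2 * d 2 := (pow_pos hρi 2).trans h2
  have p3 : 0 < -d 1 ^ 3 + 3 * d 1 * d 2 - 3 * d 3 := (pow_pos hρi 3).trans h3
  have hD0 : D ≠ 0 := by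
    intro h
    rw [s2, h] at p2
    simp at p2
  have hE0 : E ≠ 0 := by
    intro h
    rw [s3, h] at p3
    simp at p3
  refine ⟨?_, ?_, ?_, ?_⟩
  · calc _ = (-d 1)⁻¹ := by rw [s1, inv_div]
      _ < ρ := inv_lt_of_inv_lt₀ hρ h1
  · calc ρ < -d 1 / (d 1 ^ 2 - 2 * d 2) := by
          rw [lt_div_iff₀ p2]
          rwa [lt_inv_mul_iff₀ hρ] at h4
      _ = _ := by
          rw [s1, s2]
          field_simp
          ring
  · refine lt_of_pow_lt_pow_left₀ 2 hρ.le ?_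
    -- The radicand is `S_1²/S_2` and its prefactor is `1/S_1`, so this bound is `S_2^(-1/2)`.
    have hX : 2 * (a * q - 1) * (q + 1) / D =
        (2 * q / ((1 - q) * (1 - a))) ^ 2 * (d 1 ^ 2 - 2 * d 2)⁻¹ := by
      rw [s2]
      field_simp
      ring
    rw [mul_pow, Real.sq_sqrt (by rw [hX]; positivity), hX]
    calc _ = (d 1 ^ 2 - 2 * d 2)⁻¹ := by
          field_simp
          ring
      _ < ρ ^ 2 := inv_lt_of_inv_lt₀ (by positivity) (by rwa [← inv_pow])
  · calc ρ < (d 1 ^ 2 - 2 * d 2) / (-d 1 ^ 3 + 3 * d 1 * d 2 - 3 * d 3) := by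
          rw [lt_div_iff₀ p3]
          rwa [lt_inv_mul_iff₀ hρ] at h5
      _ = _ := by
          rw [s2, s3]
          field_simp
          ring

end

theorem theorem6 (ν q : ℝ) (hν : -1 < ν) (hq0 : 0 < q) (hq1 : q < 1) :
    -- the radius is the smallest positive root of `√r J'(√r) - (ν - 2) J(√r) = 0`
    IsLeast {r : ℝ | 0 < r ∧
        ((√r : ℝ) : ℂ) * deriv (hahnExton ν q) ((√r : ℝ) : ℂ)
          - ((ν : ℂ) - 2) * hahnExton ν q ((√r : ℝ) : ℂ) = 0}
      (starlikenessRadius (hNorm ν q)) ∧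
    -- first pair of bounds
    (1 - q) * (1 - q ^ (ν + 1)) / (2 * q) < starlikenessRadius (hNorm ν q) ∧
    starlikenessRadius (hNorm ν q) <
      (q ^ 2 - 1) * (q ^ (ν + 1) - 1) * (q ^ (ν + 2) - 1) /
        (q * (q - q ^ (ν + 2) + 2 * q ^ (ν + 3) - 2)) ∧
    -- second pair of bounds
    (q - 1) * (q ^ (ν + 1) - 1) / (2 * q) *
        √(2 * (q ^ (ν + 2) - 1) * (q + 1) / (q - q ^ (ν + 2) + 2 * q ^ (ν + 3) - 2))
      < starlikenessRadius (hNorm ν q) ∧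
    starlikenessRadius (hNorm ν q) <
      (q ^ (ν + 1) - 1) * (q ^ (ν + 3) - 1) * (1 - q) / (q * (q + 1)) * qFourStar ν q := by
  have ha1 : q ^ (ν + 1) < 1 := Real.rpow_lt_one hq0.le hq1 (by linarith)
  have ha0 : 0 < q ^ (ν + 1) := Real.rpow_pos_of_pos hq0 _
  -- Degree and number of shifts grow together; the offset `2` guarantees the two roots needed for
  -- strictness.
  choose y hy using fun N => exists_qSeparated_qApprox hq0 hq1 ha0 ha1 (N + 2) (N + 2)
  obtain ⟨ρ, hρ, h0, hpos, hre, h1, h2, h3, h4, h5⟩ := exists_first_zero hq0 hq1 hy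
    (fun n => (Filter.tendsto_add_atTop_iff_nat 2).2 (tendsto_coeff_qApprox hq0 hq1 ha0 ha1 n))
    (fun N n => abs_coeff_qApprox_le hq0 hq1 ha0 ha1 (N + 2) n)
    (summable_hahnExtonCoeff hq0 hq1 ha0 ha1) (d := hNormDerivCoeff (q ^ (ν + 1)) q) fun _ => rfl
  rw [starlikenessRadius_eq hν hq0 hq1 hρ h0 hre]
  refine ⟨⟨⟨hρ, (hahnExton_equation_iff hν hq0 hq1 hρ).2 h0⟩, fun r hr => ?_⟩, ?_⟩
  · by_contra! h
    exact (hpos r hr.1.le h).ne' ((hahnExton_equation_iff hν hq0 hq1 hr.1).1 hr.2)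
  have hpow : ∀ (s : ℝ) (k : ℕ), s = ν + 1 + k → q ^ s = q ^ (ν + 1) * q ^ k := fun s k hs => by
    rw [hs, Real.rpow_add hq0, Real.rpow_natCast]
  have hpow2 : ∀ (s : ℝ) (k : ℕ), s = ν + 1 + (ν + 1) + k →
      q ^ s = (q ^ (ν + 1)) ^ 2 * q ^ k := fun s k hs => by
    rw [hs, Real.rpow_add hq0, Real.rpow_add hq0, Real.rpow_natCast, sq]
  rw [qFourStar, hpow (ν + 2) 1 (by push_cast; ring), hpow (ν + 3) 2 (by push_cast; ring),
    hpow (ν + 4) 3 (by push_cast; ring), hpow (ν + 5) 4 (by push_cast; ring),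
    hpow (ν + 6) 5 (by push_cast; ring), hpow2 (2 * ν + 5) 3 (by push_cast; ring),
    hpow2 (2 * ν + 6) 4 (by push_cast; ring), hpow2 (2 * ν + 7) 5 (by push_cast; ring),
    hpow2 (2 * ν + 8) 6 (by push_cast; ring), pow_one]
  exact bounds_of_power_sums hq0 hq1 ha1 hρ rfl h1 h2 h3 h4 h5
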